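/- Let $G$ be a finite simple graph with vertex set $V$, equipped with a total order. Suppose that $G$ is strongly regular with parameters $(v,k,\lambda,\mu)$: it has $v$ vertices, it is $k$-regular, any two adjacent vertices have exactly $\lambda$ common neighbours, and any two distinct non-adjacent vertices have exactly $\mu$ common neighbours. Suppose further that (a) for any two distinct non-adjacent vertices $x,y$ of $G$, the subgraph of $G$ induced on the set $\Gamma(x)\cap\Gamma(y)$ of their common neighbours is connected (the graph with no vertices is counted as connected here); (b) every induced $5$-cycle of $G$ has four vertices that have a common neighbour in $G$. Let $X$ be the clique complex of $G$, and let $X_i$ be the set of its $i$-dimensional faces, that is, of the sets of $i+1$ pairwise adjacent vertices of $G$. For $i\ge 0$ let $\delta_i:\mathbb{R}^{X_i}\to\mathbb{R}^{X_{i+1}}$ be the coboundary map, given by the matrix with entries $(\delta_i)_{H,F}=[H:F]$ for $H\in X_{i+1}$, $F\in X_i$, where, for $H=\{x_0<x_1<\dots<x_{i+1}\}$, $[H:F]=(-1)^j$ if $F=H\setminus\{x_j\}$, and $[H:F]=0$ if $F\not\subset H$. Then $$\ker\delta_1=\operatorname{im}\delta_0 .$$ -/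

import Mathlib

/-- The clique complex of a graph: its faces are the nonempty finite sets of pairwise adjacent
vertices. -/
def SimpleGraph.cliqueComplex {V : Type*} (G : SimpleGraph V) : AbstractSimplicialComplex V where
  faces := {F | F.Nonempty ∧ G.IsClique (F : Set V)}
  isRelLowerSet_faces := fun {_} hF =>
    ⟨hF.1, fun _ hKF hK => ⟨hK, hF.2.subset (Finset.coe_subset.mpr hKF)⟩⟩
  singleton_mem := fun v => ⟨Finset.singleton_nonempty v, by simp⟩

namespace AbstractSimplicialComplex

/-- `X.Face i` is the type `X_i` of `i`-dimensional faces of `X`, those with `i + 1` vertices. -/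
def Face {V : Type*} (X : AbstractSimplicialComplex V) (i : ℕ) : Type _ :=
  {F : Finset V // F ∈ X.faces ∧ F.card = i + 1}

noncomputable instance {V : Type*} [Finite V] (X : AbstractSimplicialComplex V) (i : ℕ) :
    Fintype (X.Face i) :=
  have : Finite (X.Face i) := Subtype.finite
  Fintype.ofFinite _

/-- The signed incidence number `[F : K]` of finite sets `F` and `K` of vertices. If
`F = {x_0 < x_1 < ... < x_i}` and `K = F \ {x_j}` then it is `(-1) ^ j` (and `j` is the number of
elements of `F` below `x_j`); if `K` is not of this form then it is `0`. At most one summand is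
nonzero. -/
def incidence {V : Type*} [LinearOrder V] (F K : Finset V) : ℝ :=
  ∑ x ∈ F, if F.erase x = K then (-1) ^ (F.filter (· < x)).card else 0

theorem incidence_erase {V : Type*} [LinearOrder V] {F : Finset V} {x : V} (hx : x ∈ F) :
    incidence F (F.erase x) = (-1) ^ (F.filter (· < x)).card := by
  unfold incidence
  rw [Finset.sum_eq_single_of_mem x hx]
  · simp
  · intro y hy hyx
    rw [if_neg]
    intro h
    exact hyx (Finset.erase_injOn F hy hx h)

theorem incidence_eq_zero {V : Type*} [LinearOrder V] {F K : Finset V}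
    (h : ∀ x ∈ F, F.erase x ≠ K) : incidence F K = 0 :=
  Finset.sum_eq_zero fun x hx => if_neg (h x hx)

/-- The matrix of the coboundary map `δ_i : ℝ^{X_i} → ℝ^{X_{i+1}}`. -/
def coboundary {V : Type*} [LinearOrder V] (X : AbstractSimplicialComplex V) (i : ℕ) :
    Matrix (X.Face (i + 1)) (X.Face i) ℝ :=
  Matrix.of fun H F => incidence H.1 F.1

end AbstractSimplicialComplex

/-! That `im δ₀ ⊆ ker δ₁` is the usual cancellation over a triangle. Conversely, read a 1-cochain
killed by `δ₁` as an antisymmetric function on oriented edges that sums to zero around triangles; it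
is a coboundary once it has a potential. Strong regularity puts all vertices of a component within
distance two of a base point, and the potential is the sum along a shortest path from there.
Checking it on an edge means summing around a closed walk of length at most five. Hypothesis (a)
makes the sum around quadrangles vanish (`IsCocycle.add_eq_add`), so two-step path sums depend only
on the endpoints. Pentagons with a chord split into triangles and quadrangles, and induced ones are
handled by (b) (`IsCocycle.pentagon_of_embedding`). -/

namespace SimpleGraph

/-! ### Cocycles on quadrangles and pentagons -/

variable {V : Type*} {G : SimpleGraph V} {g : V → V → ℝ}

/-- An antisymmetric function on ordered pairs of vertices that sums to zero around triangles. -/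
structure IsCocycle (G : SimpleGraph V) (g : V → V → ℝ) : Prop where
  antisymm : ∀ x y, G.Adj x y → g y x = -g x y
  triangle : ∀ x y z, G.Adj x y → G.Adj y z → G.Adj x z → g x z = g x y + g y z

/-- Moving the midpoint along an edge `p r` between common neighbours crosses the triangles `x p r`
and `p r y`, whose contributions cancel; connectedness then links any two midpoints. -/
theorem IsCocycle.add_eq_add_of_not_adj (hg : G.IsCocycle g)
    (hconn : ∀ x y : V, x ≠ y → ¬ G.Adj x y → (G.induce (G.commonNeighbors x y)).Preconnected)
    {x y a b : V} (hxy : x ≠ y) (hn : ¬ G.Adj x y) (hxa : G.Adj x a) (hay : G.Adj a y)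
    (hxb : G.Adj x b) (hby : G.Adj b y) : g x a + g a y = g x b + g b y := by
  obtain ⟨w⟩ := hconn x y hxy hn ⟨a, hxa, hay.symm⟩ ⟨b, hxb, hby.symm⟩
  suffices h : ∀ p q : G.commonNeighbors x y, (G.induce (G.commonNeighbors x y)).Walk p q →
      g x p + g p y = g x q + g q y from h _ _ w
  intro p q w
  induction w with
  | nil => rfl
  | @cons p r q hpr _ ih =>
    have hadj : G.Adj p r := hpr
    have h₁ := hg.triangle x p r p.2.1 hadj r.2.1
    have h₂ := hg.triangle p r y hadj r.2.2.symm p.2.2.symm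
    linarith

theorem IsCocycle.add_eq_add (hg : G.IsCocycle g)
    (hconn : ∀ x y : V, x ≠ y → ¬ G.Adj x y → (G.induce (G.commonNeighbors x y)).Preconnected)
    {x y a b : V} (hxa : G.Adj x a) (hay : G.Adj a y) (hxb : G.Adj x b) (hby : G.Adj b y) :
    g x a + g a y = g x b + g b y := by
  by_cases hxy : x = y
  · subst hxy
    rw [hg.antisymm x a hxa, hg.antisymm x b hxb]
    ring
  by_cases hn : G.Adj x y
  · rw [← hg.triangle x a y hxa hay hn, ← hg.triangle x b y hxb hby hn]
  exact hg.add_eq_add_of_not_adj hconn hxy hn hxa hay hxb hby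

/-- A cocycle vanishes on a pentagon four of whose vertices have a common neighbour. -/
theorem IsCocycle.pentagon_of_common_neighbor (hg : G.IsCocycle g)
    (hconn : ∀ x y : V, x ≠ y → ¬ G.Adj x y → (G.induce (G.commonNeighbors x y)).Preconnected)
    {a b c d e w : V} (hab : G.Adj a b) (hbc : G.Adj b c) (hcd : G.Adj c d) (hde : G.Adj d e)
    (hea : G.Adj e a) (ha : G.Adj w a) (hb : G.Adj w b) (hc : G.Adj w c) (hd : G.Adj w d) :
    g a b + g b c + g c d + g d e + g e a = 0 := by
  have h₁ := hg.triangle w a b ha hab hb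
  have h₂ := hg.triangle w b c hb hbc hc
  have h₃ := hg.triangle w c d hc hcd hd
  have h₄ := hg.add_eq_add hconn hde hea hd.symm ha
  have h₅ := hg.antisymm w d hd
  linarith

theorem IsCocycle.pentagon_of_embedding (hg : G.IsCocycle g)
    (hconn : ∀ x y : V, x ≠ y → ¬ G.Adj x y → (G.induce (G.commonNeighbors x y)).Preconnected)
    (c : cycleGraph 5 ↪g G) {S : Finset (Fin 5)} (hS : S.card = 4) {w : V}
    (hw : ∀ i ∈ S, G.Adj w (c i)) :
    g (c 0) (c 1) + g (c 1) (c 2) + g (c 2) (c 3) + g (c 3) (c 4) + g (c 4) (c 0) = 0 := by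
  have hadj : ∀ i j, (cycleGraph 5).Adj i j → G.Adj (c i) (c j) := fun i j h =>
    c.map_rel_iff.2 h
  have h01 := hadj 0 1 (by decide)
  have h12 := hadj 1 2 (by decide)
  have h23 := hadj 2 3 (by decide)
  have h34 := hadj 3 4 (by decide)
  have h40 := hadj 4 0 (by decide)
  -- Only one vertex `i` can fail to be adjacent to `w`; rotate the pentagon so that it comes last.
  obtain ⟨i, hi⟩ : ∃ i, Sᶜ = {i} := Finset.card_eq_one.1 (by rw [Finset.card_compl, hS]; rfl)
  have hw' : ∀ j, j ≠ i → G.Adj w (c j) := fun j hj => hw j <| by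
    by_contra h
    exact hj (Finset.mem_singleton.1 (hi ▸ Finset.mem_compl.2 h))
  fin_cases i
  · linarith [hg.pentagon_of_common_neighbor hconn h12 h23 h34 h40 h01 (hw' 1 (by decide))
      (hw' 2 (by decide)) (hw' 3 (by decide)) (hw' 4 (by decide))]
  · linarith [hg.pentagon_of_common_neighbor hconn h23 h34 h40 h01 h12 (hw' 2 (by decide))
      (hw' 3 (by decide)) (hw' 4 (by decide)) (hw' 0 (by decide))]
  · linarith [hg.pentagon_of_common_neighbor hconn h34 h40 h01 h12 h23 (hw' 3 (by decide))
      (hw' 4 (by decide)) (hw' 0 (by decide)) (hw' 1 (by decide))]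
  · linarith [hg.pentagon_of_common_neighbor hconn h40 h01 h12 h23 h34 (hw' 4 (by decide))
      (hw' 0 (by decide)) (hw' 1 (by decide)) (hw' 2 (by decide))]
  · linarith [hg.pentagon_of_common_neighbor hconn h01 h12 h23 h34 h40 (hw' 0 (by decide))
      (hw' 1 (by decide)) (hw' 2 (by decide)) (hw' 3 (by decide))]

/-- Five vertices in cyclic order with no chord span an induced 5-cycle. -/
theorem exists_embedding_cycleGraph_five {a b c d e : V} (hab : G.Adj a b) (hbc : G.Adj b c)
    (hcd : G.Adj c d) (hde : G.Adj d e) (hea : G.Adj e a) (hac : ¬ G.Adj a c) (hbd : ¬ G.Adj b d)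
    (hce : ¬ G.Adj c e) (hda : ¬ G.Adj d a) (heb : ¬ G.Adj e b) :
    ∃ f : cycleGraph 5 ↪g G, f 0 = a ∧ f 1 = b ∧ f 2 = c ∧ f 3 = d ∧ f 4 = e := by
  have hadj : ∀ i j, G.Adj (![a, b, c, d, e] i) (![a, b, c, d, e] j) ↔
      (cycleGraph 5).Adj i j := by
    intro i j
    fin_cases i <;> fin_cases j <;>
      simp [cycleGraph_adj, hab, hbc, hcd, hde, hea, hac, hbd, hce, hda, heb, hab.symm, hbc.symm,
        hcd.symm, hde.symm, hea.symm, G.adj_comm c a, G.adj_comm d b, G.adj_comm e c,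
        G.adj_comm a d, G.adj_comm b e] <;> decide
  -- Distinct vertices of the 5-cycle have distinct neighbourhoods, so injectivity follows from the
  -- adjacency pattern alone.
  have hsep : ∀ i j : Fin 5, i ≠ j →
      ∃ m, ¬ ((cycleGraph 5).Adj i m ↔ (cycleGraph 5).Adj j m) := by decide
  refine ⟨⟨⟨![a, b, c, d, e], fun i j hij => ?_⟩, fun {i j} => hadj i j⟩, rfl, rfl, rfl, rfl, rfl⟩
  by_contra hne
  obtain ⟨m, hm⟩ := hsep i j hne
  exact hm (by rw [← hadj, ← hadj, hij])

/-! ### Potentials from path sums -/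

open Classical in
/-- The sum of `g` along a shortest path from `x` to `y`, for vertices at distance at most two. -/
noncomputable def pathSum (G : SimpleGraph V) (g : V → V → ℝ) (x y : V) : ℝ :=
  if x = y then 0 else if G.Adj x y then g x y else
    if h : ∃ a, G.Adj x a ∧ G.Adj a y then g x h.choose + g h.choose y else 0

theorem pathSum_self (x : V) : G.pathSum g x x = 0 := by simp [pathSum]

theorem pathSum_of_adj {x y : V} (h : G.Adj x y) : G.pathSum g x y = g x y := by
  simp [pathSum, h, h.ne]

theorem IsCocycle.pathSum_eq_add (hg : G.IsCocycle g)
    (hconn : ∀ x y : V, x ≠ y → ¬ G.Adj x y → (G.induce (G.commonNeighbors x y)).Preconnected)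
    {x y a : V} (hxa : G.Adj x a) (hay : G.Adj a y) : G.pathSum g x y = g x a + g a y := by
  by_cases hxy : x = y
  · subst hxy
    rw [pathSum_self, hg.antisymm x a hxa]
    ring
  by_cases hn : G.Adj x y
  · rw [pathSum_of_adj hn, hg.triangle x a y hxa hay hn]
  have h : ∃ a, G.Adj x a ∧ G.Adj a y := ⟨a, hxa, hay⟩
  rw [pathSum, if_neg hxy, if_neg hn, dif_pos h]
  exact hg.add_eq_add hconn h.choose_spec.1 h.choose_spec.2 hxa hay

/-- Any coincidence or chord in the closed walk `o a x y b` leaves only triangles and quadrangles;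
otherwise the walk is an induced pentagon. -/
theorem IsCocycle.pathSum_add (hg : G.IsCocycle g)
    (hconn : ∀ x y : V, x ≠ y → ¬ G.Adj x y → (G.induce (G.commonNeighbors x y)).Preconnected)
    (hcycle : ∀ c : cycleGraph 5 ↪g G,
      ∃ S : Finset (Fin 5), S.card = 4 ∧ ∃ w : V, ∀ i ∈ S, G.Adj w (c i))
    {o x y : V} (hxy : G.Adj x y)
    (hx : o = x ∨ G.Adj o x ∨ ∃ a, G.Adj o a ∧ G.Adj a x)
    (hy : o = y ∨ G.Adj o y ∨ ∃ a, G.Adj o a ∧ G.Adj a y) :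
    G.pathSum g o x + g x y = G.pathSum g o y := by
  by_cases hox : o = x
  · subst hox
    rw [pathSum_self, pathSum_of_adj hxy, zero_add]
  by_cases hoy : o = y
  · subst hoy
    rw [pathSum_self, pathSum_of_adj hxy.symm, hg.antisymm x o hxy]
    ring
  by_cases hax : G.Adj o x
  · rw [hg.pathSum_eq_add hconn hax hxy, pathSum_of_adj hax]
  by_cases hay : G.Adj o y
  · rw [hg.pathSum_eq_add hconn hay hxy.symm, pathSum_of_adj hay, hg.antisymm x y hxy]
    ring
  obtain ⟨a, hoa, hax'⟩ := (hx.resolve_left hox).resolve_left hax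
  obtain ⟨b, hob, hby⟩ := (hy.resolve_left hoy).resolve_left hay
  by_cases hay' : G.Adj a y
  · rw [hg.pathSum_eq_add hconn hoa hax', hg.pathSum_eq_add hconn hoa hay',
      hg.triangle a x y hax' hxy hay']
    ring
  by_cases hbx : G.Adj b x
  · rw [hg.pathSum_eq_add hconn hob hbx, hg.pathSum_eq_add hconn hob hby,
      hg.triangle b x y hbx hxy hby]
    ring
  rw [hg.pathSum_eq_add hconn hoa hax', hg.pathSum_eq_add hconn hob hby]
  by_cases hab : G.Adj a b
  · have h₁ := hg.add_eq_add hconn hax' hxy hab hby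
    have h₂ := hg.triangle o a b hoa hab hob
    linarith
  obtain ⟨f, rfl, rfl, rfl, rfl, rfl⟩ := exists_embedding_cycleGraph_five hoa hax' hxy hby.symm
    hob.symm hax hay' (fun h => hbx h.symm) (fun h => hay h.symm) (fun h => hab h.symm)
  obtain ⟨S, hS, w, hw⟩ := hcycle f
  have h₁ := hg.pentagon_of_embedding hconn f hS hw
  have h₂ := hg.antisymm _ _ hob
  have h₃ := hg.antisymm _ _ hby
  linarith

/-- The components of a strongly regular graph have diameter at most two. -/
theorem IsSRGWith.eq_or_adj_or_exists_of_reachable [Fintype V] [DecidableEq V]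
    [DecidableRel G.Adj] {v k l μ : ℕ} (hG : G.IsSRGWith v k l μ) {x y : V}
    (h : G.Reachable x y) : x = y ∨ G.Adj x y ∨ ∃ a, G.Adj x a ∧ G.Adj a y := by
  by_contra hcon
  push Not at hcon
  obtain ⟨hxy, hn, hno⟩ := hcon
  -- A pair at distance greater than two forces `μ = 0`. Then adjacency is transitive on distinct
  -- vertices, so components are complete and the pair could not be joined by a walk.
  have hμ : μ = 0 := by
    rw [← hG.of_not_adj hxy hn, Fintype.card_eq_zero_iff]
    exact ⟨fun a => hno a a.2.1 a.2.2.symm⟩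
  have htrans : ∀ a b c, G.Adj a b → G.Adj b c → a = c ∨ G.Adj a c := by
    intro a b c hab hbc
    by_contra hcon
    push Not at hcon
    have hcard := hG.of_not_adj hcon.1 hcon.2
    rw [hμ, Fintype.card_eq_zero_iff] at hcard
    exact hcard.false ⟨b, hab, hbc.symm⟩
  obtain ⟨w⟩ := h
  have hw : x = y ∨ G.Adj x y := by
    clear hxy hn hno
    induction w with
    | nil => exact Or.inl rfl
    | cons hab _ ih =>
      rcases ih with rfl | h
      · exact Or.inr hab
      · exact htrans _ _ _ hab h
  exact hw.elim hxy hn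

/-- Every cocycle is the difference of a function on the vertices. -/
theorem IsCocycle.exists_potential [Fintype V] [DecidableEq V] [DecidableRel G.Adj]
    (hg : G.IsCocycle g) {v k l μ : ℕ} (hG : G.IsSRGWith v k l μ)
    (hconn : ∀ x y : V, x ≠ y → ¬ G.Adj x y → (G.induce (G.commonNeighbors x y)).Preconnected)
    (hcycle : ∀ c : cycleGraph 5 ↪g G,
      ∃ S : Finset (Fin 5), S.card = 4 ∧ ∃ w : V, ∀ i ∈ S, G.Adj w (c i)) :
    ∃ p : V → ℝ, ∀ x y, G.Adj x y → g x y = p y - p x := by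
  -- `G` may be disconnected, so each component gets its own base point.
  let rep : V → V := fun x => (G.connectedComponentMk x).out
  have hrep : ∀ x, G.Reachable (rep x) x := fun x =>
    ConnectedComponent.exact (Quot.out_eq (G.connectedComponentMk x))
  refine ⟨fun x => G.pathSum g (rep x) x, fun x y hxy => ?_⟩
  have heq : rep y = rep x := congrArg Quot.out (ConnectedComponent.sound hxy.symm.reachable)
  have h := hg.pathSum_add hconn hcycle (o := rep x) hxy
    (hG.eq_or_adj_or_exists_of_reachable (hrep x))
    (hG.eq_or_adj_or_exists_of_reachable (heq ▸ hrep y))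
  simp only [heq]
  linarith

end SimpleGraph

/-! ### Coboundaries in low degree -/

namespace AbstractSimplicialComplex

variable {V : Type*}

theorem erase_mem_faces [DecidableEq V] (X : AbstractSimplicialComplex V) {i : ℕ}
    (H : X.Face (i + 1)) {x : V} (hx : x ∈ H.1) :
    H.1.erase x ∈ X.faces ∧ (H.1.erase x).card = i + 1 := by
  have hcard : (H.1.erase x).card = i + 1 := by rw [Finset.card_erase_of_mem hx, H.2.2]; rfl
  exact ⟨(X.isRelLowerSet_faces H.2.1).2 (Finset.erase_subset _ _)
    (Finset.card_pos.1 (by omega)), hcard⟩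

open Classical in
/-- Extension of a cochain by zero to all finite sets of vertices. -/
noncomputable def extend (X : AbstractSimplicialComplex V) {i : ℕ} (h : X.Face i → ℝ)
    (F : Finset V) : ℝ :=
  if hF : F ∈ X.faces ∧ F.card = i + 1 then h ⟨F, hF⟩ else 0

theorem extend_val (X : AbstractSimplicialComplex V) {i : ℕ} (h : X.Face i → ℝ) (F : X.Face i) :
    X.extend h F.1 = h F := dif_pos F.2

theorem coboundary_mulVec_apply [Fintype V] [LinearOrder V] (X : AbstractSimplicialComplex V)
    {i : ℕ} (h : X.Face i → ℝ) (H : X.Face (i + 1)) :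
    (X.coboundary i).mulVec h H =
      ∑ x ∈ H.1, (-1) ^ (H.1.filter (· < x)).card * X.extend h (H.1.erase x) := by
  simp only [Matrix.mulVec, dotProduct, coboundary, Matrix.of_apply, incidence, Finset.sum_mul]
  rw [Finset.sum_comm]
  refine Finset.sum_congr rfl fun x hx => ?_
  have hF := X.erase_mem_faces H hx
  let K : X.Face i := ⟨H.1.erase x, hF⟩
  rw [Finset.sum_eq_single_of_mem K (Finset.mem_univ _)]
  · rw [if_pos rfl, extend, dif_pos hF]
  · intro F _ hne
    rw [if_neg fun h => hne (Subtype.ext h.symm), zero_mul]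

theorem coboundary_zero_mulVec_pair [Fintype V] [LinearOrder V] (X : AbstractSimplicialComplex V)
    (p : X.Face 0 → ℝ) {x y : V} (hxy : x < y) (H : X.Face 1) (hH : H.1 = {x, y}) :
    (X.coboundary 0).mulVec p H = X.extend p {y} - X.extend p {x} := by
  have e₁ : ({x, y} : Finset V).erase x = {y} := by grind
  have e₂ : ({x, y} : Finset V).erase y = {x} := by grind
  have f₁ : ({x, y} : Finset V).filter (· < x) = ∅ := by grind
  have f₂ : ({x, y} : Finset V).filter (· < y) = {x} := by grind
  rw [coboundary_mulVec_apply, hH, Finset.sum_pair hxy.ne, e₁, e₂, f₁, f₂]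
  simp
  ring

theorem coboundary_one_mulVec_triple [Fintype V] [LinearOrder V] (X : AbstractSimplicialComplex V)
    (h : X.Face 1 → ℝ) {x y z : V} (hxy : x < y) (hyz : y < z) (H : X.Face 2)
    (hH : H.1 = {x, y, z}) :
    (X.coboundary 1).mulVec h H = X.extend h {y, z} - X.extend h {x, z} + X.extend h {x, y} := by
  have hxz := hxy.trans hyz
  have e₁ : ({x, y, z} : Finset V).erase x = {y, z} := by grind
  have e₂ : ({x, y, z} : Finset V).erase y = {x, z} := by grind
  have e₃ : ({x, y, z} : Finset V).erase z = {x, y} := by grind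
  have f₁ : ({x, y, z} : Finset V).filter (· < x) = ∅ := by grind
  have f₂ : ({x, y, z} : Finset V).filter (· < y) = {x} := by grind
  have f₃ : ({x, y, z} : Finset V).filter (· < z) = {x, y} := by grind
  rw [coboundary_mulVec_apply, hH, Finset.sum_insert (by grind), Finset.sum_pair hyz.ne,
    e₁, e₂, e₃, f₁, f₂, f₃, Finset.card_pair hxy.ne]
  simp
  ring

theorem Face.exists_pair [LinearOrder V] {X : AbstractSimplicialComplex V} (H : X.Face 1) :
    ∃ x y, x < y ∧ H.1 = {x, y} := by
  obtain ⟨x, y, hne, hH⟩ := Finset.card_eq_two.1 H.2.2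
  rcases hne.lt_or_gt with h | h
  · exact ⟨x, y, h, hH⟩
  · exact ⟨y, x, h, by rw [hH, Finset.pair_comm]⟩

theorem Face.exists_triple [LinearOrder V] {X : AbstractSimplicialComplex V} (H : X.Face 2) :
    ∃ x y z, x < y ∧ y < z ∧ H.1 = {x, y, z} := by
  let e := H.1.orderEmbOfFin H.2.2
  refine ⟨e 0, e 1, e 2, e.strictMono (by decide), e.strictMono (by decide), ?_⟩
  have huniv : (Finset.univ : Finset (Fin (2 + 1))) = {0, 1, 2} := by decide
  have himage := Finset.image_orderEmbOfFin_univ H.1 H.2.2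
  rw [huniv, Finset.image_insert, Finset.image_insert, Finset.image_singleton] at himage
  exact himage.symm

theorem coboundary_one_mulVec_coboundary_zero_mulVec [Fintype V] [LinearOrder V]
    (X : AbstractSimplicialComplex V) (p : X.Face 0 → ℝ) :
    (X.coboundary 1).mulVec ((X.coboundary 0).mulVec p) = 0 := by
  funext H
  obtain ⟨x, y, z, hxy, hyz, hH⟩ := H.exists_triple
  have hxz := hxy.trans hyz
  -- Exhibiting the edge as `H` minus a vertex shows that it is a face, so `extend` does not take
  -- its default value there.
  have key : ∀ a b c : V, a ∈ H.1 → H.1.erase a = {b, c} → b < c →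
      X.extend ((X.coboundary 0).mulVec p) {b, c} = X.extend p {c} - X.extend p {b} := by
    intro a b c ha he hbc
    have hF := X.erase_mem_faces H ha
    let K : X.Face 1 := ⟨H.1.erase a, hF⟩
    rw [← X.coboundary_zero_mulVec_pair p hbc K he, ← he]
    exact X.extend_val _ K
  rw [X.coboundary_one_mulVec_triple _ hxy hyz H hH,
    key x y z (by grind) (by grind) hyz,
    key y x z (by grind) (by grind) hxz,
    key z x y (by grind) (by grind) hxy]
  simp

end AbstractSimplicialComplex

/-! ### From 1-cochains to cocycles and back -/

namespace SimpleGraph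

variable {V : Type*} [LinearOrder V] {G : SimpleGraph V}

theorem pair_mem_cliqueComplex {x y : V} (hxy : G.Adj x y) :
    ({x, y} : Finset V) ∈ G.cliqueComplex.faces ∧ ({x, y} : Finset V).card = 1 + 1 :=
  ⟨⟨by simp, by simpa using fun _ => hxy⟩, Finset.card_pair hxy.ne⟩

theorem triple_mem_cliqueComplex {x y z : V} (hxy : G.Adj x y) (hyz : G.Adj y z)
    (hxz : G.Adj x z) : ({x, y, z} : Finset V) ∈ G.cliqueComplex.faces ∧
      ({x, y, z} : Finset V).card = 2 + 1 := by
  have h : G.IsNClique 3 {x, y, z} := is3Clique_triple_iff.2 ⟨hxy, hxz, hyz⟩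
  exact ⟨⟨by simp, h.isClique⟩, h.card_eq⟩

/-- The antisymmetric function on ordered pairs given by a 1-cochain. -/
noncomputable def orient (G : SimpleGraph V) (h : G.cliqueComplex.Face 1 → ℝ) (x y : V) : ℝ :=
  if x < y then G.cliqueComplex.extend h {x, y} else -G.cliqueComplex.extend h {x, y}

theorem orient_isCocycle [Fintype V] {h : G.cliqueComplex.Face 1 → ℝ}
    (hh : (G.cliqueComplex.coboundary 1).mulVec h = 0) : G.IsCocycle (G.orient h) := by
  have key : ∀ x y z, x < y → y < z → G.Adj x y → G.Adj y z → G.Adj x z →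
      G.cliqueComplex.extend h {y, z} - G.cliqueComplex.extend h {x, z} +
        G.cliqueComplex.extend h {x, y} = 0 := by
    intro x y z hlt hlt' hxy hyz hxz
    rw [← G.cliqueComplex.coboundary_one_mulVec_triple h hlt hlt'
      ⟨_, triple_mem_cliqueComplex hxy hyz hxz⟩ rfl, hh]
    rfl
  refine ⟨fun x y hxy => ?_, fun x y z hxy hyz hxz => ?_⟩
  · rcases hxy.ne.lt_or_gt with hlt | hlt
    · simp [orient, hlt, hlt.not_gt, Finset.pair_comm y x]
    · simp [orient, hlt, hlt.not_gt, Finset.pair_comm y x]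
  · have c₁ := Finset.pair_comm y x
    have c₂ := Finset.pair_comm z y
    have c₃ := Finset.pair_comm z x
    unfold orient
    -- Of the eight sign patterns two are cyclic and impossible; the other six are the orderings of
    -- the triangle, each reduced to the sorted identity `key`.
    rcases hxy.ne.lt_or_gt with h₁ | h₁ <;> rcases hyz.ne.lt_or_gt with h₂ | h₂ <;>
      rcases hxz.ne.lt_or_gt with h₃ | h₃
    · have := key x y z h₁ h₂ hxy hyz hxz
      simp only [h₁, h₂, h₃, if_true]
      linarith
    · exact absurd (h₁.trans h₂) h₃.not_gt
    · have := key x z y h₃ h₂ hxz hyz.symm hxy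
      simp only [h₁, h₂.not_gt, h₃, if_true, if_false]
      rw [c₂] at this
      linarith
    · have := key z x y h₃ h₁ hxz.symm hxy hyz.symm
      simp only [h₁, h₂.not_gt, h₃.not_gt, if_true, if_false]
      rw [c₂, c₃] at this
      linarith
    · have := key y x z h₁ h₃ hxy.symm hxz hyz
      simp only [h₁.not_gt, h₂, h₃, if_true, if_false]
      rw [c₁] at this
      linarith
    · have := key y z x h₂ h₃ hyz hxz.symm hxy.symm
      simp only [h₁.not_gt, h₂, h₃.not_gt, if_true, if_false]
      rw [c₁, c₃] at this
      linarith
    · exact absurd (h₂.trans h₁) h₃.not_gt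
    · have := key z y x h₂ h₁ hyz.symm hxy.symm hxz.symm
      simp only [h₁.not_gt, h₂.not_gt, h₃.not_gt, if_false]
      rw [c₁, c₂, c₃] at this
      linarith

theorem exists_mulVec_coboundary_zero_eq [Fintype V] {h : G.cliqueComplex.Face 1 → ℝ} {p : V → ℝ}
    (hp : ∀ x y, G.Adj x y → G.orient h x y = p y - p x) :
    ∃ q, (G.cliqueComplex.coboundary 0).mulVec q = h := by
  -- The sum has a single term; it reads off `p` at the vertex of `F` without choosing it.
  let q : G.cliqueComplex.Face 0 → ℝ := fun F => ∑ x ∈ F.1, p x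
  have hq : ∀ x, G.cliqueComplex.extend q {x} = p x := fun x => by
    rw [G.cliqueComplex.extend_val q ⟨{x}, G.cliqueComplex.singleton_mem x, by simp⟩]
    exact Finset.sum_singleton _ _
  refine ⟨q, funext fun H => ?_⟩
  obtain ⟨x, y, hlt, hH⟩ := H.exists_pair
  have hadj : G.Adj x y := H.2.1.2 (by simp [hH]) (by simp [hH]) hlt.ne
  rw [G.cliqueComplex.coboundary_zero_mulVec_pair q hlt H hH, hq, hq, ← hp x y hadj, orient,
    if_pos hlt, ← hH, G.cliqueComplex.extend_val]

end SimpleGraph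

theorem mainTheorem4 {V : Type*} [Fintype V] [LinearOrder V] (G : SimpleGraph V)
    [DecidableRel G.Adj] (v k l μ : ℕ) (hG : G.IsSRGWith v k l μ)
    (hconn : ∀ x y : V, x ≠ y → ¬ G.Adj x y →
      (G.induce (G.commonNeighbors x y)).Preconnected)
    (hcycle : ∀ c : SimpleGraph.cycleGraph 5 ↪g G,
      ∃ S : Finset (Fin 5), S.card = 4 ∧ ∃ w : V, ∀ i ∈ S, G.Adj w (c i)) :
    LinearMap.ker (G.cliqueComplex.coboundary 1).mulVecLin =
      LinearMap.range (G.cliqueComplex.coboundary 0).mulVecLin := by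
  ext h
  rw [LinearMap.mem_ker, LinearMap.mem_range]
  constructor
  · intro hh
    obtain ⟨p, hp⟩ := (SimpleGraph.orient_isCocycle hh).exists_potential hG hconn hcycle
    exact SimpleGraph.exists_mulVec_coboundary_zero_eq hp
  · rintro ⟨p, rfl⟩
    exact G.cliqueComplex.coboundary_one_mulVec_coboundary_zero_mulVec p
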